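/- Let $\mathcal G=(\mathcal V,\mathcal E)$ be a finite directed network (multigraph) with unit-capacity edges, source $S$ and sink $D$. Some edges have unit delay and the others are instantaneous; every directed cycle contains at least one delayed edge. Let $\mathcal A$ be an arbitrary nonempty collection of wiretap sets $A\subseteq\mathcal E$. A code runs for $T\ge 1$ time steps over an alphabet with $s\ge 2$ symbols. The source has a random message $M$ with finitely many values, and every node $v$ (source, sink, or any other) may generate a random key $K_v$; the message and all keys are independent. On each edge $e=(u,v)$ one symbol is sent at each time $t$; it is a function of $K_u$, of $M$ if $u=S$, and of the symbols sent on the edges entering $u$ at times $<t$ (and also at time $t$ on the instantaneous ones). The sink must recover $M$ with zero error probability from $K_D$ and all symbols sent on edges entering $D$, and perfect secrecy must hold: $I(M;X(A))=0$ for all $A\in\mathcal A$, where $X(A)$ denotes all the signals sent on the edges in $A$ during the $T$ steps. The rate is $H(M)/(T\log s)$, and the secrecy capacity $\mathfrak C$ is the supremum of the rates of all such codes. Let $V\subset\mathcal V$ be a cut with $S\in V$, $D\notin V$. Let $e^{\rm fwd}_1,\dots,e^{\rm fwd}_x$ be the edges from $V$ to $V^c$ and $e^{\rm bwd}_1,\dots,e^{\rm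 bwd}_y$ the edges from $V^c$ to $V$. Let $C_{b\to f}$ be the $x\times y$ matrix whose $(i,j)$ entry is $1$ if there is a directed path (possibly of length zero) from the head of $e^{\rm bwd}_j$ to the tail of $e^{\rm fwd}_i$ that passes through no node of $V^c$, and $0$ otherwise, and let $$C=\begin{pmatrix}C_{b\to f}\\ I_y\end{pmatrix},$$ whose rows correspond to the cut edges. Put $\mathcal A_V=\{A\cap\{e^{\rm fwd}_1,\dots,e^{\rm fwd}_x,e^{\rm bwd}_1,\dots,e^{\rm bwd}_y\}:A\in\mathcal A\}$. For $A\in\mathcal A_V$ let $U_A$ be the submatrix of $C$ formed by the rows corresponding to edges in $A$. Let $\bar C$ be any $(x+y)\times y$ matrix over a finite field $\mathbb F_q$ such that $\bar C$ vanishes wherever $C$ does and, for every $A\in\mathcal A_V$, the corresponding submatrix $\bar U_A$ of $\bar C$ has the largest rank among all matrices over $\mathbb F_q$ of the size of $U_A$ that vanish wherever $U_A$ does. (Such a $\bar C$ exists whenever $q$ is large enough.) Then $$\mathfrak C\;\le\; x+\min_{A\in\mathcal A_V}\bigl(\operatorname{rank}(\bar U_A)-|A|\bigr).$$ -/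

import Mathlib

open MeasureTheory

/-- A directed network (multigraph) with node set `Node` and edge set `Edge`, every edge having unit
capacity.  An edge `e` is directed from `tail e` to `head e`.  Edges in `delayed` have unit delay,
the other edges are instantaneous; for causality no directed cycle is made of instantaneous edges
only.  (All edges delayed, or an acyclic network without any delay, are special cases.) -/
structure SecureNetwork (Node Edge : Type*) where
  tail : Edge → Node
  head : Edge → Node
  source : Node
  sink : Node
  delayed : Set Edge
  causal : ∀ v : Node,
    ¬ Relation.TransGen (fun u w => ∃ e, e ∉ delayed ∧ tail e = u ∧ head e = w) v v

namespace SecureNetwork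

variable {Node Edge : Type*}

/-- The pairs `(e', s)` such that the symbol sent on `e'` at time `s` is known to `tail e` when it
chooses the symbol to be sent on `e` at time `t`. -/
abbrev Visible (N : SecureNetwork Node Edge) {T : ℕ} (e : Edge) (t : Fin T) : Type _ :=
  {p : Edge × Fin T // N.head p.1 = N.tail e ∧ (p.2 < t ∨ (p.2 = t ∧ p.1 ∉ N.delayed))}

/-- The pairs `(e, s)` such that the sink receives the symbol sent on `e` at time `s`. -/
abbrev Received (N : SecureNetwork Node Edge) (T : ℕ) : Type _ :=
  {p : Edge × Fin T // N.head p.1 = N.sink}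

/-- What the node `v` knows of the message `m`: everything if it is the source, nothing otherwise. -/
noncomputable def msgView (N : SecureNetwork Node Edge) {k : ℕ} (v : Node) (m : Fin k) :
    Option (Fin k) :=
  open Classical in if v = N.source then some m else none

/-- A coding scheme that finishes within `T` time steps, over an alphabet with `q` symbols.
The message is distributed on `Fin msgCard` by `msgLaw`; each node `v` (source and sink included)
generates a key in an arbitrary probability space `Key v`; message and keys are all independent.
At each time, one symbol is sent on each edge `e`. It is a function of the message (if `tail e` is
the source), of the key of `tail e` and of the symbols visible to `tail e`. -/
structure Code (N : SecureNetwork Node Edge) where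
  T : ℕ
  T_pos : 0 < T
  q : ℕ
  two_le_q : 2 ≤ q
  msgCard : ℕ
  msgLaw : ProbabilityMeasure (Fin msgCard)
  Key : Node → Type
  [keySpace : ∀ v, MeasurableSpace (Key v)]
  keyLaw : ∀ v, ProbabilityMeasure (Key v)
  enc : ∀ (e : Edge) (t : Fin T),
    Option (Fin msgCard) → Key (N.tail e) → (N.Visible e t → Fin q) → Fin q
  enc_measurable : ∀ e t m h, Measurable (fun k => enc e t m k h)
  dec : Key N.sink → (N.Received T → Fin q) → Fin msgCard
  dec_measurable : ∀ h, Measurable (fun k => dec k h)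
  /-- The symbol sent on an edge at a time, as a function of the message and all the keys. -/
  signal : Edge → Fin T → Fin msgCard × (∀ v, Key v) → Fin q
  signal_eq : ∀ e t ω, signal e t ω =
    enc e t (N.msgView (N.tail e) ω.1) (ω.2 (N.tail e)) (fun p => signal p.1.1 p.1.2 ω)

namespace Code

attribute [instance] Code.keySpace

variable {N : SecureNetwork Node Edge}

/-- The sample space of a code: the message and the keys of all nodes. -/
abbrev Sample (c : N.Code) : Type _ := Fin c.msgCard × (∀ v, c.Key v)

/-- The joint law of the message and of the keys, all independent. -/
noncomputable def law [Fintype Node] (c : N.Code) : Measure c.Sample :=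
  (c.msgLaw : Measure (Fin c.msgCard)).prod
    (Measure.pi fun v => (c.keyLaw v : Measure (c.Key v)))

/-- The signals `X(A)` transmitted on the edges in `A` during all time steps. -/
def signals (c : N.Code) (A : Finset Edge) (ω : c.Sample) : A → Fin c.T → Fin c.q :=
  fun e t => c.signal e t ω

/-- The mutual information `I(X;Y)`, as the divergence of the joint law from the product law. -/
noncomputable def mutualInfo {Ω α β : Type*} [MeasurableSpace Ω] [MeasurableSpace α]
    [MeasurableSpace β] (μ : Measure Ω) (X : Ω → α) (Y : Ω → β) : ENNReal :=
  InformationTheory.klDiv (μ.map fun ω => (X ω, Y ω)) ((μ.map X).prod (μ.map Y))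

/-- Decoding constraint: the sink recovers the message, with zero error probability, from its own
key and the symbols it receives. -/
def Decodes [Fintype Node] (c : N.Code) : Prop :=
  ∀ᵐ ω ∂c.law, c.dec (ω.2 N.sink) (fun p => c.signal p.1.1 p.1.2 ω) = ω.1

/-- Perfect secrecy `I(M; X(A)) = 0` for every wiretap set `A` of the collection. -/
def Secure [Fintype Node] (c : N.Code) (𝒜 : Finset (Finset Edge)) : Prop :=
  ∀ A ∈ 𝒜, mutualInfo c.law (fun ω => ω.1) (c.signals A) = 0

/-- The message entropy `H(M)` in nats. -/
noncomputable def msgEntropy (c : N.Code) : ℝ :=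
  ∑ m : Fin c.msgCard, Real.negMulLog ((c.msgLaw : Measure (Fin c.msgCard)).real {m})

/-- The rate `H(M) / T`, the entropy being measured in alphabet symbols. -/
noncomputable def rate (c : N.Code) : ℝ := c.msgEntropy / (c.T * Real.log c.q)

end Code

/-- The secrecy capacity: the supremum of the rates of the codes that are decodable and perfectly
secure, over all alphabets, numbers of time steps, message sets and keys. -/
noncomputable def secrecyCapacity [Fintype Node] (N : SecureNetwork Node Edge)
    (𝒜 : Finset (Finset Edge)) : EReal :=
  ⨆ (c : N.Code) (_ : c.Decodes) (_ : c.Secure 𝒜), (c.rate : EReal)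

section Cut

variable [DecidableEq Node] [Fintype Edge]

/-- Forward edges of the cut `V`. -/
def fwd (N : SecureNetwork Node Edge) (V : Finset Node) : Finset Edge :=
  {e | N.tail e ∈ V ∧ N.head e ∉ V}

/-- Backward edges of the cut `V`. -/
def bwd (N : SecureNetwork Node Edge) (V : Finset Node) : Finset Edge :=
  {e | N.tail e ∉ V ∧ N.head e ∈ V}

/-- There is a directed path (possibly of length zero) from `u` to `w` none of whose edges has an
endpoint outside `V`. -/
def PathWithin (N : SecureNetwork Node Edge) (V : Finset Node) (u w : Node) : Prop :=
  Relation.ReflTransGen (fun a b => a ∈ V ∧ b ∈ V ∧ ∃ e, N.tail e = a ∧ N.head e = b) u w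

/-- The 0-1 connectivity matrix from the backward edges to the forward edges. -/
noncomputable def connMatrix (N : SecureNetwork Node Edge) (V : Finset Node) :
    Matrix (N.fwd V) (N.bwd V) ℕ :=
  open Classical in
  fun i j => if N.PathWithin V (N.head j) (N.tail i) then 1 else 0

/-- The connectivity matrix stacked on the identity matrix; the rows are the cut edges. -/
noncomputable def cutMatrix [DecidableEq Edge] (N : SecureNetwork Node Edge) (V : Finset Node) :
    Matrix (N.fwd V ⊕ N.bwd V) (N.bwd V) ℕ :=
  Matrix.fromRows (N.connMatrix V) 1

/-- The cut edge to which a row corresponds. -/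
def rowEdge (N : SecureNetwork Node Edge) (V : Finset Node) : N.fwd V ⊕ N.bwd V → Edge :=
  Sum.elim Subtype.val Subtype.val

/-- The submatrix formed by the rows that correspond to edges in `A`. -/
def rowsIn (N : SecureNetwork Node Edge) (V : Finset Node) {R : Type*}
    (M : Matrix (N.fwd V ⊕ N.bwd V) (N.bwd V) R) (A : Finset Edge) :
    Matrix {r : N.fwd V ⊕ N.bwd V // N.rowEdge V r ∈ A} (N.bwd V) R :=
  M.submatrix Subtype.val id

/-- The traces of the wiretap sets on the cut. -/
def cutWiretaps [DecidableEq Edge] (N : SecureNetwork Node Edge) (V : Finset Node)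
    (𝒜 : Finset (Finset Edge)) : Finset (Finset Edge) :=
  𝒜.image fun A => A ∩ (N.fwd V ∪ N.bwd V)

/-- `Cbar` vanishes where the cut matrix does and, for every trace `A` of a wiretap set on the cut,
the rank of its submatrix with rows in `A` is the largest rank of a matrix over `F` of that size
which vanishes where the corresponding submatrix of the cut matrix does. -/
def IsRankMaximized [DecidableEq Edge] (N : SecureNetwork Node Edge) (V : Finset Node)
    (𝒜 : Finset (Finset Edge)) {F : Type*} [Field F]
    (Cbar : Matrix (N.fwd V ⊕ N.bwd V) (N.bwd V) F) : Prop :=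
  (∀ i j, N.cutMatrix V i j = 0 → Cbar i j = 0) ∧
  ∀ A ∈ N.cutWiretaps V 𝒜,
    IsGreatest
      {r : ℕ | ∃ W : Matrix {i : N.fwd V ⊕ N.bwd V // N.rowEdge V i ∈ A} (N.bwd V) F,
        (∀ i j, N.rowsIn V (N.cutMatrix V) A i j = 0 → W i j = 0) ∧ W.rank = r}
      (N.rowsIn V Cbar A).rank

end Cut

end SecureNetwork

/-!
The maximal rank of a matrix with prescribed zeros is the largest size of a matching between its
rows and columns, so by the deficiency form of Hall's theorem (`exists_matrix_rank_ge`) every trace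
`A` has a set `S` of rows, with `B` the set of columns on which they do not all vanish, such that
`rank - |A| ≥ |B| - |S|`. Split the edges of `S` into forward edges `F₀` and backward edges `B₀`;
the identity block gives `B₀ ⊆ B`, and the connectivity block says that the tails of the edges of
`F₀` can be reached within `V` only from the backward edges in `B`. It remains to show
`H(M) ≤ T log q (|fwd \ F₀| + |B \ B₀|)`, which is `Code.entropy_message_le`.

A code is seen as a dialogue between the two sides of the cut. The inner side consists of the
message and of the strategies of the nodes in `V`, the outer side of the strategies of the other
nodes. A strategy is the family of encoding functions that a key selects: keys may range over
infinite spaces, but strategies have finitely many values, so that all entropies are finite sums.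
The two sides are independent. `X_fwd` and the outer side determine the message and all that crosses
the cut, while `X_B` and the inner side determine `X_F₀`. Running through the events (an edge and a
time) in a causal order, submodularity gives (`Code.entropy_history_le`)

  `H(X_fwd | outer) + H(X_B | inner) ≤ H(X_{F₀ ∪ B}) + T |fwd \ F₀| log q`.

One more use of submodularity, with the independence of the two sides, bounds
`H(M, X_{F₀ ∪ B})` by the left-hand side, hence `H(M | X_{F₀ ∪ B}) ≤ T |fwd \ F₀| log q`. Secrecy
gives `H(M) = H(M | X_{F₀ ∪ B₀})`, and leaving out `B \ B₀` from the condition costs at most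
`T |B \ B₀| log q`.
-/

namespace SecureNetwork

/-! ### Entropy of finitely valued random variables -/

section Entropy

variable {Ω : Type*} [MeasurableSpace Ω] {μ : Measure Ω}

/-- The Shannon entropy, in nats, of a random variable with finitely many values. -/
noncomputable def entropy {α : Type*} [Finite α] (μ : Measure Ω) (X : Ω → α) : ℝ :=
  letI := Fintype.ofFinite α
  ∑ x, Real.negMulLog (μ.real (X ⁻¹' {x}))

/-- `X` determines `Y` almost surely. -/
def Determines {α β : Type*} (μ : Measure Ω) (X : Ω → α) (Y : Ω → β) : Prop :=
  ∃ g : α → β, Y =ᵐ[μ] g ∘ X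

theorem entropy_eq_sum {α : Type*} [Fintype α] (μ : Measure Ω) (X : Ω → α) :
    entropy μ X = ∑ x, Real.negMulLog (μ.real (X ⁻¹' {x})) := by
  unfold entropy
  congr!

theorem entropy_nonneg {α : Type*} [Finite α] (μ : Measure Ω) [IsProbabilityMeasure μ]
    (X : Ω → α) : 0 ≤ entropy μ X := by
  have := Fintype.ofFinite α
  rw [entropy_eq_sum]
  exact Finset.sum_nonneg fun x _ => Real.negMulLog_nonneg measureReal_nonneg measureReal_le_one

theorem entropy_congr {α : Type*} [Finite α] {X Y : Ω → α} (h : X =ᵐ[μ] Y) :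
    entropy μ X = entropy μ Y := by
  have := Fintype.ofFinite α
  simp only [entropy_eq_sum]
  refine Finset.sum_congr rfl fun x _ => ?_
  congr 1
  refine measureReal_congr ?_
  filter_upwards [h] with ω hω
  change (X ω ∈ ({x} : Set α)) = (Y ω ∈ ({x} : Set α))
  rw [hω]

theorem Determines.of_forall {α β : Type*} [Nonempty Ω] {X : Ω → α} {Y : Ω → β}
    (h : ∀ ω ω', X ω = X ω' → Y ω = Y ω') : Determines μ X Y := by
  have : Nonempty β := (inferInstance : Nonempty Ω).map Y
  obtain ⟨g, hg⟩ := (Function.factorsThrough_iff Y).1 (fun ω ω' hω => h ω ω' hω)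
  exact ⟨g, by rw [hg]⟩

theorem Determines.prodMk {α β γ : Type*} {X : Ω → α} {Y : Ω → β} {Z : Ω → γ}
    (hY : Determines μ X Y) (hZ : Determines μ X Z) :
    Determines μ X fun ω => (Y ω, Z ω) := by
  obtain ⟨g, hg⟩ := hY
  obtain ⟨g', hg'⟩ := hZ
  refine ⟨fun a => (g a, g' a), ?_⟩
  filter_upwards [hg, hg'] with ω h h'
  simp [h, h']

theorem Determines.congr_right {α β : Type*} {X : Ω → α} {Y Y' : Ω → β}
    (h : Determines μ X Y) (hY : Y =ᵐ[μ] Y') : Determines μ X Y' := by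
  obtain ⟨g, hg⟩ := h
  exact ⟨g, hY.symm.trans hg⟩

/-- The expectation of `φ (g X)`, computed from the law of `g X` and from that of `X`. -/
theorem sum_mul_measureReal_comp {α β : Type*} [Fintype α] [Fintype β] [MeasurableSpace α]
    [MeasurableSingletonClass α] [IsFiniteMeasure μ] {X : Ω → α} (hX : Measurable X) (g : α → β)
    (φ : β → ℝ) :
    ∑ y, μ.real ((fun ω => g (X ω)) ⁻¹' {y}) * φ y = ∑ x, μ.real (X ⁻¹' {x}) * φ (g x) := by
  classical
  have key : ∀ y, μ.real ((fun ω => g (X ω)) ⁻¹' {y}) =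
      ∑ x with g x = y, μ.real (X ⁻¹' {x}) := by
    intro y
    rw [← measureReal_biUnion_finset]
    · congr 1
      ext ω
      simp
    · intro a _ b _ hab
      exact Disjoint.preimage _ (by simpa using hab)
    · exact fun x _ => hX (measurableSet_singleton x)
  simp only [key, Finset.sum_mul]
  rw [← Finset.sum_fiberwise Finset.univ g fun x => μ.real (X ⁻¹' {x}) * φ (g x)]
  refine Finset.sum_congr rfl fun y _ => Finset.sum_congr rfl fun x hx => ?_
  rw [(Finset.mem_filter.1 hx).2]

theorem sum_measureReal_preimage {α : Type*} [Fintype α] [MeasurableSpace α]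
    [MeasurableSingletonClass α] [IsProbabilityMeasure μ] {X : Ω → α} (hX : Measurable X) :
    ∑ x, μ.real (X ⁻¹' {x}) = 1 := by
  have := sum_mul_measureReal_comp (μ := μ) hX (fun _ => ()) (fun _ => 1)
  simpa using this.symm

theorem entropy_comp_eq_sum {α β : Type*} [Fintype α] [Finite β] [MeasurableSpace α]
    [MeasurableSingletonClass α] [IsFiniteMeasure μ] {X : Ω → α} (hX : Measurable X) (g : α → β) :
    entropy μ (fun ω => g (X ω)) =
      ∑ x, -(μ.real (X ⁻¹' {x}) * Real.log (μ.real ((fun ω => g (X ω)) ⁻¹' {g x}))) := by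
  have := Fintype.ofFinite β
  rw [entropy_eq_sum, Finset.sum_neg_distrib,
    ← sum_mul_measureReal_comp hX g
      (fun y => Real.log (μ.real ((fun ω => g (X ω)) ⁻¹' {y}))), ← Finset.sum_neg_distrib]
  simp [Real.negMulLog]

theorem measureReal_preimage_le_comp {α β : Type*} [IsFiniteMeasure μ] (X : Ω → α) (g : α → β)
    (x : α) : μ.real (X ⁻¹' {x}) ≤ μ.real ((fun ω => g (X ω)) ⁻¹' {g x}) :=
  measureReal_mono fun ω hω => congrArg g hω

theorem Determines.entropy_le {α β : Type*} [Finite α] [Finite β] [MeasurableSpace α]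
    [MeasurableSingletonClass α] [IsFiniteMeasure μ] {X : Ω → α} {Y : Ω → β} (hX : Measurable X)
    (h : Determines μ X Y) : entropy μ Y ≤ entropy μ X := by
  have := Fintype.ofFinite α
  obtain ⟨g, hg⟩ := h
  rw [entropy_congr hg]
  change entropy μ (fun ω => g (X ω)) ≤ _
  rw [entropy_comp_eq_sum hX g, entropy_eq_sum]
  refine Finset.sum_le_sum fun x _ => ?_
  rw [Real.negMulLog, neg_mul, neg_le_neg_iff]
  rcases (measureReal_nonneg : 0 ≤ μ.real (X ⁻¹' {x})).eq_or_lt with h0 | h0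
  · simp [← h0]
  · exact mul_le_mul_of_nonneg_left
      (Real.log_le_log h0 (measureReal_preimage_le_comp X g x)) h0.le

theorem entropy_le_log_card {α : Type*} [Fintype α] [MeasurableSpace α]
    [MeasurableSingletonClass α] [IsProbabilityMeasure μ] {X : Ω → α} (hX : Measurable X) :
    entropy μ X ≤ Real.log (Fintype.card α) := by
  have hsum := sum_measureReal_preimage (μ := μ) hX
  have hne : Nonempty α := by
    by_contra h
    rw [not_nonempty_iff] at h
    simp at hsum
  have hn : (0 : ℝ) < Fintype.card α := by exact_mod_cast Fintype.card_pos
  have key : ∀ x, Real.negMulLog (μ.real (X ⁻¹' {x})) ≤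
      μ.real (X ⁻¹' {x}) * Real.log (Fintype.card α) +
        ((Fintype.card α : ℝ)⁻¹ - μ.real (X ⁻¹' {x})) := by
    intro x
    rcases (measureReal_nonneg : 0 ≤ μ.real (X ⁻¹' {x})).eq_or_lt with h0 | h0
    · simp [← h0]
    · set p := μ.real (X ⁻¹' {x})
      have h := Real.log_le_sub_one_of_pos (x := ((Fintype.card α : ℝ) * p)⁻¹) (by positivity)
      rw [Real.log_inv, Real.log_mul hn.ne' h0.ne'] at h
      have h2 := mul_le_mul_of_nonneg_left h h0.le
      have h3 : p * (((Fintype.card α : ℝ) * p)⁻¹ - 1) = (Fintype.card α : ℝ)⁻¹ - p := by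
        field_simp
      rw [h3] at h2
      rw [Real.negMulLog]
      linarith
  rw [entropy_eq_sum]
  refine (Finset.sum_le_sum fun x _ => key x).trans ?_
  rw [Finset.sum_add_distrib, ← Finset.sum_mul, Finset.sum_sub_distrib, hsum]
  simp [hn.ne']

theorem neg_mul_log_add_le {p z a b : ℝ} (hp : 0 ≤ p) (hz : p ≤ z) (ha : p ≤ a) (hb : p ≤ b) :
    -(p * Real.log p) + -(p * Real.log z) ≤
      (-(p * Real.log a) + -(p * Real.log b)) + (a * b / z - p) := by
  rcases hp.eq_or_lt with rfl | h0
  · simp only [zero_mul, neg_zero, add_zero, zero_add, sub_zero]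
    positivity
  · have hz0 := h0.trans_le hz
    have ha0 := h0.trans_le ha
    have hb0 := h0.trans_le hb
    have h := Real.log_le_sub_one_of_pos (x := a * b / (p * z)) (by positivity)
    rw [Real.log_div (by positivity) (by positivity), Real.log_mul ha0.ne' hb0.ne',
      Real.log_mul h0.ne' hz0.ne'] at h
    have h' := mul_le_mul_of_nonneg_left h h0.le
    have e : p * (a * b / (p * z) - 1) = a * b / z - p := by
      field_simp
    rw [e] at h'
    linarith

/-- Nonnegativity of the conditional mutual information `I(X;Y|Z)`. -/
theorem entropy_submodular_prod {α β γ : Type*} [Finite α] [Finite β] [Finite γ]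
    [MeasurableSpace α] [MeasurableSingletonClass α] [MeasurableSpace β]
    [MeasurableSingletonClass β] [MeasurableSpace γ] [MeasurableSingletonClass γ]
    [IsProbabilityMeasure μ] {X : Ω → α} {Y : Ω → β} {Z : Ω → γ} (hX : Measurable X)
    (hY : Measurable Y) (hZ : Measurable Z) :
    entropy μ (fun ω => (X ω, Y ω, Z ω)) + entropy μ Z ≤
      entropy μ (fun ω => (X ω, Z ω)) + entropy μ (fun ω => (Y ω, Z ω)) := by
  have := Fintype.ofFinite α
  have := Fintype.ofFinite β
  have := Fintype.ofFinite γ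
  set J : Ω → α × β × γ := fun ω => (X ω, Y ω, Z ω) with hJ
  have hJm : Measurable J := hX.prodMk (hY.prodMk hZ)
  have e1 := entropy_comp_eq_sum (μ := μ) hJm id
  have e2 := entropy_comp_eq_sum (μ := μ) hJm fun u => u.2.2
  have e3 := entropy_comp_eq_sum (μ := μ) hJm fun u => (u.1, u.2.2)
  have e4 := entropy_comp_eq_sum (μ := μ) hJm fun u => (u.2.1, u.2.2)
  simp only [id, hJ] at e1 e2 e3 e4
  rw [e1, e2, e3, e4, ← Finset.sum_add_distrib, ← Finset.sum_add_distrib]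
  set p : α × β × γ → ℝ := fun u => μ.real (J ⁻¹' {u}) with hp
  set pz : γ → ℝ := fun z => μ.real (Z ⁻¹' {z}) with hpz
  set pxz : α × γ → ℝ := fun u => μ.real ((fun ω => (X ω, Z ω)) ⁻¹' {u}) with hpxz
  set pyz : β × γ → ℝ := fun u => μ.real ((fun ω => (Y ω, Z ω)) ⁻¹' {u}) with hpyz
  have hz : ∀ u, p u ≤ pz u.2.2 := measureReal_preimage_le_comp J fun u => u.2.2
  have hxz : ∀ u, p u ≤ pxz (u.1, u.2.2) := measureReal_preimage_le_comp J fun u => (u.1, u.2.2)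
  have hyz : ∀ u, p u ≤ pyz (u.2.1, u.2.2) :=
    measureReal_preimage_le_comp J fun u => (u.2.1, u.2.2)
  have key : ∀ u, -(p u * Real.log (p u)) + -(p u * Real.log (pz u.2.2)) ≤
      (-(p u * Real.log (pxz (u.1, u.2.2))) + -(p u * Real.log (pyz (u.2.1, u.2.2)))) +
        (pxz (u.1, u.2.2) * pyz (u.2.1, u.2.2) / pz u.2.2 - p u) :=
    fun u => neg_mul_log_add_le measureReal_nonneg (hz u) (hxz u) (hyz u)
  refine (Finset.sum_le_sum fun u _ => key u).trans ?_
  rw [Finset.sum_add_distrib, Finset.sum_sub_distrib]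
  have hs : ∑ u, p u = 1 := sum_measureReal_preimage hJm
  have hmx : ∀ z, ∑ x, pxz (x, z) = pz z := by
    classical
    intro z
    have := sum_mul_measureReal_comp (μ := μ) (hX.prodMk hZ) (fun u => u.2)
      fun z' => if z' = z then 1 else 0
    simpa [Fintype.sum_prod_type] using this.symm
  have hmy : ∀ z, ∑ y, pyz (y, z) = pz z := by
    classical
    intro z
    have := sum_mul_measureReal_comp (μ := μ) (hY.prodMk hZ) (fun u => u.2)
      fun z' => if z' = z then 1 else 0
    simpa [Fintype.sum_prod_type] using this.symm
  have hle : ∑ u : α × β × γ, pxz (u.1, u.2.2) * pyz (u.2.1, u.2.2) / pz u.2.2 = 1 := by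
    calc ∑ u : α × β × γ, pxz (u.1, u.2.2) * pyz (u.2.1, u.2.2) / pz u.2.2
        = ∑ z, (∑ x, pxz (x, z)) * (∑ y, pyz (y, z)) / pz z := by
          simp only [Fintype.sum_prod_type, Finset.sum_mul_sum, Finset.sum_div]
          rw [Finset.sum_comm' (t' := Finset.univ) (s' := fun _ => Finset.univ) (by simp)]
          rw [Finset.sum_congr rfl fun y _ => Finset.sum_comm, Finset.sum_comm]
          refine Finset.sum_congr rfl fun z _ => Finset.sum_comm
      _ = ∑ z, pz z := by
          refine Finset.sum_congr rfl fun z _ => ?_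
          rw [hmx, hmy, mul_self_div_self]
      _ = 1 := sum_measureReal_preimage hZ
  rw [hle, hs, sub_self, add_zero]

/-- Submodularity of the entropy: `D` is common information of `A` and `B`, while `C` is part of
their joint information. -/
theorem entropy_submodular {α β γ δ : Type*} [Finite α] [Finite β] [Finite γ] [Finite δ]
    [MeasurableSpace α] [MeasurableSingletonClass α] [MeasurableSpace β]
    [MeasurableSingletonClass β] [MeasurableSpace δ] [MeasurableSingletonClass δ]
    [IsProbabilityMeasure μ] {A : Ω → α} {B : Ω → β} {C : Ω → γ} {D : Ω → δ} (hA : Measurable A)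
    (hB : Measurable B) (hD : Measurable D) (hAD : Determines μ A D) (hBD : Determines μ B D)
    (hC : Determines μ (fun ω => (A ω, B ω)) C) :
    entropy μ C + entropy μ D ≤ entropy μ A + entropy μ B := by
  have h1 := entropy_submodular_prod (μ := μ) hA hB hD
  have h2 : entropy μ C ≤ entropy μ (fun ω => (A ω, B ω, D ω)) := by
    refine Determines.entropy_le (hA.prodMk (hB.prodMk hD)) ?_
    obtain ⟨g, hg⟩ := hC
    exact ⟨fun u => g (u.1, u.2.1), hg⟩
  have h3 : entropy μ (fun ω => (A ω, D ω)) ≤ entropy μ A :=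
    Determines.entropy_le hA (Determines.prodMk ⟨id, by rfl⟩ hAD)
  have h4 : entropy μ (fun ω => (B ω, D ω)) ≤ entropy μ B :=
    Determines.entropy_le hB (Determines.prodMk ⟨id, by rfl⟩ hBD)
  linarith

theorem entropy_le_add_log_card {α β γ : Type*} [Finite α] [Fintype β] [Finite γ]
    [MeasurableSpace α] [MeasurableSingletonClass α] [MeasurableSpace β]
    [MeasurableSingletonClass β] [IsProbabilityMeasure μ] {A : Ω → α} {B : Ω → β} {C : Ω → γ}
    (hA : Measurable A) (hB : Measurable B) (hC : Determines μ (fun ω => (A ω, B ω)) C) :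
    entropy μ C ≤ entropy μ A + Real.log (Fintype.card β) := by
  have h := entropy_submodular (μ := μ) (D := fun _ => ()) hA hB measurable_const
    ⟨fun _ => (), by rfl⟩ ⟨fun _ => (), by rfl⟩ hC
  have h1 := entropy_le_log_card (μ := μ) hB
  have h2 : entropy μ (fun _ : Ω => ()) = 0 := by simp [entropy_eq_sum]
  linarith

theorem entropy_prod_of_indepFun {α β : Type*} [Finite α] [Finite β] [MeasurableSpace α]
    [MeasurableSingletonClass α] [MeasurableSpace β] [MeasurableSingletonClass β]
    [IsProbabilityMeasure μ] {X : Ω → α} {Y : Ω → β} (hX : Measurable X) (hY : Measurable Y)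
    (h : ProbabilityTheory.IndepFun X Y μ) :
    entropy μ (fun ω => (X ω, Y ω)) = entropy μ X + entropy μ Y := by
  have := Fintype.ofFinite α
  have := Fintype.ofFinite β
  have hprod : ∀ u : α × β, μ.real ((fun ω => (X ω, Y ω)) ⁻¹' {u}) =
      μ.real (X ⁻¹' {u.1}) * μ.real (Y ⁻¹' {u.2}) := by
    intro u
    have := h.measure_inter_preimage_eq_mul {u.1} {u.2} (measurableSet_singleton _)
      (measurableSet_singleton _)
    rw [measureReal_def, measureReal_def, measureReal_def, ← ENNReal.toReal_mul, ← this]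
    congr 2
    ext ω
    simp [Prod.ext_iff]
  simp only [entropy_eq_sum, hprod, Fintype.sum_prod_type, Real.negMulLog_mul,
    Finset.sum_add_distrib, ← Finset.mul_sum, ← Finset.sum_mul, sum_measureReal_preimage hX,
    sum_measureReal_preimage hY, one_mul]

end Entropy

theorem indepFun_prod_of_indepFun {α β γ δ : Type*} [MeasurableSpace α] [MeasurableSpace β]
    [MeasurableSpace γ] [MeasurableSpace δ] {μ : Measure α} {ν : Measure β}
    [IsProbabilityMeasure μ] [IsProbabilityMeasure ν] {g : β → γ} {h : β → δ} (hg : Measurable g)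
    (hh : Measurable h) (hgh : ProbabilityTheory.IndepFun g h ν) :
    ProbabilityTheory.IndepFun (fun u : α × β => (u.1, g u.2)) (fun u => h u.2) (μ.prod ν) := by
  rw [ProbabilityTheory.indepFun_iff_measure_inter_preimage_eq_mul]
  intro s t hs ht
  have hX : Measurable fun u : α × β => (u.1, g u.2) :=
    measurable_fst.prodMk (hg.comp measurable_snd)
  have ht' : (fun u : α × β => h u.2) ⁻¹' t = Set.univ ×ˢ (h ⁻¹' t) := by
    ext u; simp
  have hY : MeasurableSet ((fun u : α × β => h u.2) ⁻¹' t) := (hh.comp measurable_snd) ht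
  rw [Measure.prod_apply ((hX hs).inter hY), Measure.prod_apply (hX hs),
    ← lintegral_mul_const _ (measurable_measure_prodMk_left (hX hs)), ht', Measure.prod_prod,
    measure_univ, one_mul]
  refine lintegral_congr fun a => ?_
  have := hgh.measure_inter_preimage_eq_mul (Prod.mk a ⁻¹' s) t (measurable_prodMk_left hs) ht
  refine Eq.trans (congrArg ν ?_) this
  ext b
  simp

/-! ### Events and causality -/

variable {Node Edge : Type*}

/-- The event `p = (e, t)` of sending a symbol on `e` at time `t` may depend directly on the event
`p'`: this is the relation that defines `Visible`. -/
def Precedes (N : SecureNetwork Node Edge) {T : ℕ} (p' p : Edge × Fin T) : Prop :=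
  N.head p'.1 = N.tail p.1 ∧ (p'.2 < p.2 ∨ (p'.2 = p.2 ∧ p'.1 ∉ N.delayed))

theorem not_transGen_precedes_self (N : SecureNetwork Node Edge) {T : ℕ} (p : Edge × Fin T) :
    ¬ Relation.TransGen N.Precedes p p := by
  have key : ∀ p' : Edge × Fin T, Relation.TransGen N.Precedes p p' → p.2 < p'.2 ∨ (p.2 = p'.2 ∧
      Relation.TransGen (fun u w => ∃ e, e ∉ N.delayed ∧ N.tail e = u ∧ N.head e = w)
        (N.tail p.1) (N.tail p'.1)) := by
    intro p' h
    induction h with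
    | single h =>
      rcases h with ⟨h1, h2 | ⟨h2, h3⟩⟩
      · exact .inl h2
      · exact .inr ⟨h2, .single ⟨_, h3, rfl, h1⟩⟩
    | tail _ h ih =>
      rcases h with ⟨h1, h2 | ⟨h2, h3⟩⟩
      · rcases ih with ih | ⟨ih, -⟩
        · exact .inl (ih.trans h2)
        · exact .inl (ih ▸ h2)
      · rcases ih with ih | ⟨ih, ih'⟩
        · exact .inl (h2 ▸ ih)
        · exact .inr ⟨ih.trans h2, ih'.tail ⟨_, h3, rfl, h1⟩⟩
  intro h
  rcases key p h with h | ⟨-, h⟩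
  · exact lt_irrefl _ h
  · exact N.causal _ h

/-- The events can be numbered so that every event depends only on earlier ones: an event is given
the number of events on which it depends, directly or not. -/
theorem exists_rank [Finite Edge] (N : SecureNetwork Node Edge) (T : ℕ) :
    ∃ f : Edge × Fin T → ℕ, ∀ p' p, N.Precedes p' p → f p' < f p := by
  refine ⟨fun p => {p' | Relation.TransGen N.Precedes p' p}.ncard, fun p' p h => ?_⟩
  refine Set.ncard_lt_ncard ⟨fun p'' h'' => Relation.TransGen.tail h'' h, fun hsub => ?_⟩
    (Set.toFinite _)
  exact N.not_transGen_precedes_self p' (hsub (Relation.TransGen.single h))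

theorem wellFounded_precedes [Finite Edge] (N : SecureNetwork Node Edge) (T : ℕ) :
    WellFounded (N.Precedes (T := T)) := by
  obtain ⟨f, hf⟩ := N.exists_rank T
  exact Subrelation.wf (fun h => hf _ _ h) (measure f).wf

/-- A set of events that contains every event on which one of its members depends. -/
def IsHistory (N : SecureNetwork Node Edge) {T : ℕ} (Q : Finset (Edge × Fin T)) : Prop :=
  ∀ p ∈ Q, ∀ p', N.Precedes p' p → p' ∈ Q

theorem mem_fwd [DecidableEq Node] [Fintype Edge] (N : SecureNetwork Node Edge) {V : Finset Node}
    {e : Edge} : e ∈ N.fwd V ↔ N.tail e ∈ V ∧ N.head e ∉ V := by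
  simp [fwd]

theorem mem_bwd [DecidableEq Node] [Fintype Edge] (N : SecureNetwork Node Edge) {V : Finset Node}
    {e : Edge} : e ∈ N.bwd V ↔ N.tail e ∉ V ∧ N.head e ∈ V := by
  simp [bwd]

/-! ### The random variables of a code -/

namespace Code

variable {N : SecureNetwork Node Edge} (c : N.Code)

instance [Fintype Node] : IsProbabilityMeasure c.law := by
  unfold law; infer_instance

instance [Fintype Node] : Nonempty c.Sample :=
  c.law.nonempty_of_neZero

/-- The symbols of the events in `P`. -/
def view (P : Finset (Edge × Fin c.T)) (ω : c.Sample) : P → Fin c.q :=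
  fun p => c.signal p.1.1 p.1.2 ω

theorem view_eq_iff {P : Finset (Edge × Fin c.T)} {ω ω' : c.Sample} :
    c.view P ω = c.view P ω' ↔ ∀ p ∈ P, c.signal p.1 p.2 ω = c.signal p.1 p.2 ω' := by
  simp [view, funext_iff]

/-- The strategy for the edge `e`: the encoding functions that result from the key of the tail
of `e`.  It has finitely many values even if the key space is infinite. -/
def strategy (e : Edge) (k : c.Key (N.tail e)) (t : Fin c.T) (m : Option (Fin c.msgCard))
    (h : N.Visible e t → Fin c.q) : Fin c.q :=
  c.enc e t m k h

theorem measurable_strategy [Finite Edge] (e : Edge) : Measurable (c.strategy e) :=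
  measurable_pi_lambda _ fun t => measurable_pi_lambda _ fun m => measurable_pi_lambda _ fun h =>
    c.enc_measurable e t m h

/-- What the side of the source contributes: the message and the strategies of the nodes in `V`. -/
def inner (V : Finset Node) (ω : c.Sample) : Fin c.msgCard × ((e : {e // N.tail e ∈ V}) →
    (t : Fin c.T) → Option (Fin c.msgCard) → (N.Visible e.1 t → Fin c.q) → Fin c.q) :=
  (ω.1, fun e => c.strategy e.1 (ω.2 (N.tail e.1)))

/-- What the side of the sink contributes: the decoding strategy and the strategies of the nodes
outside `V`. -/
def outer (V : Finset Node) (ω : c.Sample) : ((N.Received c.T → Fin c.q) → Fin c.msgCard) ×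
    ((e : {e // N.tail e ∉ V}) → (t : Fin c.T) → Option (Fin c.msgCard) →
      (N.Visible e.1 t → Fin c.q) → Fin c.q) :=
  (c.dec (ω.2 N.sink), fun e => c.strategy e.1 (ω.2 (N.tail e.1)))

section Measurability

variable [Finite Edge]

theorem measurable_signal (e : Edge) (t : Fin c.T) : Measurable (c.signal e t) := by
  suffices h : ∀ p : Edge × Fin c.T, Measurable (c.signal p.1 p.2) from h (e, t)
  intro p
  induction p using (N.wellFounded_precedes c.T).induction with
  | _ p ih =>
    have h1 : Measurable fun ω : c.Sample => (c.strategy p.1 (ω.2 (N.tail p.1)), ω.1,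
        fun p' : N.Visible p.1 p.2 => c.signal p'.1.1 p'.1.2 ω) := by
      refine Measurable.prodMk ?_ (Measurable.prodMk measurable_fst ?_)
      · exact (c.measurable_strategy p.1).comp ((measurable_pi_apply _).comp measurable_snd)
      · exact measurable_pi_lambda _ fun p' => ih p'.1 p'.2
    have h2 : c.signal p.1 p.2 = (fun u : ((t : Fin c.T) → Option (Fin c.msgCard) →
        (N.Visible p.1 t → Fin c.q) → Fin c.q) × Fin c.msgCard × (N.Visible p.1 p.2 → Fin c.q) =>
          u.1 p.2 (N.msgView (N.tail p.1) u.2.1) u.2.2) ∘ fun ω : c.Sample =>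
          (c.strategy p.1 (ω.2 (N.tail p.1)), ω.1,
            fun p' : N.Visible p.1 p.2 => c.signal p'.1.1 p'.1.2 ω) := by
      funext ω
      exact c.signal_eq p.1 p.2 ω
    rw [h2]
    exact (Measurable.of_discrete).comp h1

theorem measurable_view (P : Finset (Edge × Fin c.T)) : Measurable (c.view P) :=
  measurable_pi_lambda _ fun p => c.measurable_signal p.1.1 p.1.2

theorem measurable_inner (V : Finset Node) : Measurable (c.inner V) :=
  measurable_fst.prodMk <| measurable_pi_lambda _ fun e =>
    (c.measurable_strategy e.1).comp ((measurable_pi_apply _).comp measurable_snd)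

theorem measurable_outer (V : Finset Node) : Measurable (c.outer V) := by
  refine Measurable.prodMk ?_ ?_
  · exact (measurable_pi_lambda _ fun h => c.dec_measurable h).comp
      ((measurable_pi_apply N.sink).comp measurable_snd)
  · exact measurable_pi_lambda _ fun e =>
      (c.measurable_strategy e.1).comp ((measurable_pi_apply _).comp measurable_snd)

end Measurability

/-- The two sides of the cut are independent. -/
theorem indepFun_inner_outer [Fintype Node] [DecidableEq Node] [Finite Edge] (V : Finset Node)
    (hD : N.sink ∉ V) : ProbabilityTheory.IndepFun (c.inner V) (c.outer V) c.law := by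
  have hpi : ProbabilityTheory.IndepFun (fun (k : ∀ v, c.Key v) (v : V) => k v.1)
      (fun k (v : (Vᶜ : Finset Node)) => k v.1)
      (Measure.pi fun v => (c.keyLaw v : Measure (c.Key v))) :=
    (ProbabilityTheory.iIndepFun_pi (X := fun v (k : c.Key v) => k)
      fun v => aemeasurable_id).indepFun_finset V Vᶜ disjoint_compl_right
        fun v => measurable_pi_apply v
  have hin : Measurable fun (k : ∀ v : V, c.Key v) (e : {e // N.tail e ∈ V}) =>
      c.strategy e.1 (k ⟨N.tail e.1, e.2⟩) :=
    measurable_pi_lambda _ fun e => (c.measurable_strategy e.1).comp (measurable_pi_apply _)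
  have hout : Measurable fun k : ∀ v : (Vᶜ : Finset Node), c.Key v =>
      (c.dec (k ⟨N.sink, Finset.mem_compl.2 hD⟩), fun e : {e // N.tail e ∉ V} =>
        c.strategy e.1 (k ⟨N.tail e.1, Finset.mem_compl.2 e.2⟩)) := by
    refine Measurable.prodMk ?_ ?_
    · exact (measurable_pi_lambda _ fun h => c.dec_measurable h).comp (measurable_pi_apply _)
    · exact measurable_pi_lambda _ fun e =>
        (c.measurable_strategy e.1).comp (measurable_pi_apply _)
  exact indepFun_prod_of_indepFun (hin.comp (measurable_pi_lambda _ fun v => measurable_pi_apply _))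
    (hout.comp (measurable_pi_lambda _ fun v => measurable_pi_apply _)) (hpi.comp hin hout)

/-- The events in a history with tail outside `V` are determined by the symbols sent forward across
the cut and by the strategies outside `V`. -/
theorem signal_eq_of_outer_eq [Finite Edge] [DecidableEq Node] {V : Finset Node}
    (hS : N.source ∈ V) {Q : Finset (Edge × Fin c.T)} (hQ : N.IsHistory Q) {ω ω' : c.Sample}
    (hout : c.outer V ω = c.outer V ω')
    (hfwd : ∀ p ∈ Q, N.tail p.1 ∈ V → N.head p.1 ∉ V → c.signal p.1 p.2 ω = c.signal p.1 p.2 ω')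
    {p : Edge × Fin c.T} (hp : p ∈ Q) (hpV : N.tail p.1 ∉ V) :
    c.signal p.1 p.2 ω = c.signal p.1 p.2 ω' := by
  induction p using (N.wellFounded_precedes c.T).induction with
  | _ p ih =>
    have hstrat : c.strategy p.1 (ω.2 (N.tail p.1)) = c.strategy p.1 (ω'.2 (N.tail p.1)) :=
      congrFun (congrArg Prod.snd hout) ⟨p.1, hpV⟩
    have hmsg : N.msgView (N.tail p.1) ω.1 = N.msgView (N.tail p.1) ω'.1 := by
      have : N.tail p.1 ≠ N.source := fun h => hpV (h ▸ hS)
      simp [msgView, this]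
    have hvis : (fun p' : N.Visible p.1 p.2 => c.signal p'.1.1 p'.1.2 ω) =
        fun p' => c.signal p'.1.1 p'.1.2 ω' := by
      funext p'
      have hp' : p'.1 ∈ Q := hQ p hp p'.1 p'.2
      by_cases h : N.tail p'.1.1 ∈ V
      · exact hfwd p'.1 hp' h (by rw [p'.2.1]; exact hpV)
      · exact ih p'.1 p'.2 hp' h
    rw [c.signal_eq, c.signal_eq, hvis, hmsg]
    exact congrFun (congrFun (congrFun hstrat _) _) _

/-- An event in a history with tail in `V` is determined by the message, the strategies in `V` and
the symbols sent backward across the cut on those edges from which its tail can be reached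
within `V`. -/
theorem signal_eq_of_inner_eq [Finite Edge] [DecidableEq Node] {V : Finset Node}
    {Q : Finset (Edge × Fin c.T)} (hQ : N.IsHistory Q) {ω ω' : c.Sample}
    (hin : c.inner V ω = c.inner V ω') {B : Finset Edge}
    (hbwd : ∀ p ∈ Q, p.1 ∈ B → c.signal p.1 p.2 ω = c.signal p.1 p.2 ω')
    {p : Edge × Fin c.T} (hp : p ∈ Q) (hpV : N.tail p.1 ∈ V)
    (hreach : ∀ j, N.tail j ∉ V → N.head j ∈ V → N.PathWithin V (N.head j) (N.tail p.1) → j ∈ B) :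
    c.signal p.1 p.2 ω = c.signal p.1 p.2 ω' := by
  induction p using (N.wellFounded_precedes c.T).induction with
  | _ p ih =>
    have hstrat : c.strategy p.1 (ω.2 (N.tail p.1)) = c.strategy p.1 (ω'.2 (N.tail p.1)) :=
      congrFun (congrArg Prod.snd hin) ⟨p.1, hpV⟩
    have hmsg : ω.1 = ω'.1 := (Prod.ext_iff.1 hin).1
    have hvis : (fun p' : N.Visible p.1 p.2 => c.signal p'.1.1 p'.1.2 ω) =
        fun p' => c.signal p'.1.1 p'.1.2 ω' := by
      funext p'
      have hp' : p'.1 ∈ Q := hQ p hp p'.1 p'.2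
      have hhead : N.head p'.1.1 = N.tail p.1 := p'.2.1
      by_cases h : N.tail p'.1.1 ∈ V
      · exact ih p'.1 p'.2 hp' h fun j h1 h2 h3 =>
          hreach j h1 h2 (h3.tail ⟨h, hpV, p'.1.1, rfl, hhead⟩)
      · refine hbwd p'.1 hp' (hreach _ h (by rw [hhead]; exact hpV) ?_)
        rw [hhead]
        exact Relation.ReflTransGen.refl
    rw [c.signal_eq, c.signal_eq, hvis, hmsg]
    exact congrFun (congrFun (congrFun hstrat _) _) _

/-! ### The entropy bound across the cut -/

theorem determines_view [Fintype Node] {α : Type*} {X : c.Sample → α}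
    {P : Finset (Edge × Fin c.T)}
    (h : ∀ ω ω', X ω = X ω' → ∀ p ∈ P, c.signal p.1 p.2 ω = c.signal p.1 p.2 ω') :
    Determines c.law X (c.view P) :=
  Determines.of_forall fun ω ω' hω => c.view_eq_iff.2 (h ω ω' hω)

theorem entropy_view_union_le [Fintype Node] [Fintype Edge] [DecidableEq Edge]
    (P P' : Finset (Edge × Fin c.T)) :
    entropy c.law (c.view (P ∪ P')) ≤ entropy c.law (c.view P) + P'.card * Real.log c.q := by
  have h := entropy_le_add_log_card (μ := c.law) (C := c.view (P ∪ P')) (c.measurable_view P)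
    (c.measurable_view P') (c.determines_view fun ω ω' hω p hp => by
      rw [Prod.mk.injEq, view_eq_iff, view_eq_iff] at hω
      exact (Finset.mem_union.1 hp).elim (hω.1 p) (hω.2 p))
  simpa [Fintype.card_pi] using h

/-- Adding an event on an edge of `F₀` raises `H(X_fwd, outer)` by at most as much as
`H(X_{F₀ ∪ B})`, since `X_fwd` and the side of the sink determine all that crosses the cut. -/
theorem entropy_add_entropy_le_outer [Fintype Node] [DecidableEq Node] [Fintype Edge]
    [DecidableEq Edge] {V : Finset Node} (hS : N.source ∈ V) {F₀ B : Finset Edge}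
    (hF₀ : F₀ ⊆ N.fwd V) (hB : B ⊆ N.bwd V)
    {Q Q₀ : Finset (Edge × Fin c.T)} {p : Edge × Fin c.T}
    (hmem : ∀ p', p' ∈ Q ↔ p' = p ∨ p' ∈ Q₀) (hQ₀ : N.IsHistory Q₀) (hp : p.1 ∈ F₀) :
    entropy c.law (fun ω => (c.view (Q.filter (·.1 ∈ N.fwd V)) ω, c.outer V ω)) +
        entropy c.law (c.view (Q₀.filter (·.1 ∈ F₀ ∪ B))) ≤
      entropy c.law (fun ω => (c.view (Q₀.filter (·.1 ∈ N.fwd V)) ω, c.outer V ω)) +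
        entropy c.law (c.view (Q.filter (·.1 ∈ F₀ ∪ B))) := by
  have hmo := c.measurable_outer V
  have hmv := c.measurable_view
  refine entropy_submodular ((hmv _).prodMk hmo) (hmv _) (hmv _) ?_ ?_ ?_
  · refine c.determines_view fun ω ω' hω p' hp' => ?_
    rw [Prod.mk.injEq, view_eq_iff] at hω
    simp only [Finset.mem_filter, Finset.mem_union] at hp' hω
    rcases hp' with ⟨hp', h | h⟩
    · exact hω.1 p' ⟨hp', hF₀ h⟩
    · exact c.signal_eq_of_outer_eq hS hQ₀ hω.2
        (fun p'' h1 h2 h3 => hω.1 p'' ⟨h1, N.mem_fwd.2 ⟨h2, h3⟩⟩) hp' (N.mem_bwd.1 (hB h)).1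
  · refine c.determines_view fun ω ω' hω p' hp' => ?_
    rw [view_eq_iff] at hω
    simp only [Finset.mem_filter, hmem] at hp' hω
    exact hω p' ⟨.inr hp'.1, hp'.2⟩
  · refine Determines.prodMk ?_ (.of_forall fun ω ω' hω => ?_)
    · refine c.determines_view fun ω ω' hω p' hp' => ?_
      rw [Prod.mk.injEq, Prod.mk.injEq, view_eq_iff, view_eq_iff] at hω
      simp only [Finset.mem_filter, hmem, Finset.mem_union] at hp' hω
      rcases hp' with ⟨rfl | hp', h⟩
      · exact hω.2 p' ⟨.inl rfl, .inl hp⟩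
      · exact hω.1.1 p' ⟨hp', h⟩
    · exact (Prod.ext_iff.1 (Prod.ext_iff.1 hω).1).2

theorem entropy_le_add_log_outer [Fintype Node] [Fintype Edge] [DecidableEq Edge]
    {V : Finset Node} (S : Finset Edge) {Q Q₀ : Finset (Edge × Fin c.T)} {p : Edge × Fin c.T}
    (hmem : ∀ p', p' ∈ Q ↔ p' = p ∨ p' ∈ Q₀) :
    entropy c.law (fun ω => (c.view (Q.filter (·.1 ∈ S)) ω, c.outer V ω)) ≤
      entropy c.law (fun ω => (c.view (Q₀.filter (·.1 ∈ S)) ω, c.outer V ω)) +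
        Real.log (Fintype.card (Fin c.q)) := by
  have hmo := c.measurable_outer V
  have hmv := c.measurable_view
  refine entropy_le_add_log_card ((hmv _).prodMk hmo) (c.measurable_signal p.1 p.2) ?_
  refine Determines.prodMk ?_ (.of_forall fun ω ω' hω => ?_)
  · refine c.determines_view fun ω ω' hω p' hp' => ?_
    rw [Prod.mk.injEq, Prod.mk.injEq, view_eq_iff] at hω
    simp only [Finset.mem_filter, hmem] at hp' hω
    rcases hp' with ⟨rfl | hp', h⟩
    · exact hω.2
    · exact hω.1.1 p' ⟨hp', h⟩
  · exact (Prod.ext_iff.1 (Prod.ext_iff.1 hω).1).2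

/-- Adding an event raises `H(X_B, inner)` by at most as much as `H(X_{F₀ ∪ B})`,
since `X_B` and the side of the source determine the symbols on `F₀`. -/
theorem entropy_add_entropy_le_inner [Fintype Node] [DecidableEq Node] [Fintype Edge]
    [DecidableEq Edge] {V : Finset Node} {F₀ B : Finset Edge} (hF₀ : F₀ ⊆ N.fwd V)
    (hreach : ∀ i ∈ F₀, ∀ j ∈ N.bwd V, N.PathWithin V (N.head j) (N.tail i) → j ∈ B)
    {Q Q₀ : Finset (Edge × Fin c.T)} {p : Edge × Fin c.T}
    (hmem : ∀ p', p' ∈ Q ↔ p' = p ∨ p' ∈ Q₀) (hQ₀ : N.IsHistory Q₀) :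
    entropy c.law (fun ω => (c.view (Q.filter (·.1 ∈ B)) ω, c.inner V ω)) +
        entropy c.law (c.view (Q₀.filter (·.1 ∈ F₀ ∪ B))) ≤
      entropy c.law (fun ω => (c.view (Q₀.filter (·.1 ∈ B)) ω, c.inner V ω)) +
        entropy c.law (c.view (Q.filter (·.1 ∈ F₀ ∪ B))) := by
  have hmi := c.measurable_inner V
  have hmv := c.measurable_view
  refine entropy_submodular ((hmv _).prodMk hmi) (hmv _) (hmv _) ?_ ?_ ?_
  · refine c.determines_view fun ω ω' hω p' hp' => ?_
    rw [Prod.mk.injEq, view_eq_iff] at hω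
    simp only [Finset.mem_filter, Finset.mem_union] at hp' hω
    rcases hp' with ⟨hp', h | h⟩
    · exact c.signal_eq_of_inner_eq hQ₀ hω.2 (fun p'' h1 h2 => hω.1 p'' ⟨h1, h2⟩) hp'
        (N.mem_fwd.1 (hF₀ h)).1 fun j h1 h2 h3 => hreach _ h j (N.mem_bwd.2 ⟨h1, h2⟩) h3
    · exact hω.1 p' ⟨hp', h⟩
  · refine c.determines_view fun ω ω' hω p' hp' => ?_
    rw [view_eq_iff] at hω
    simp only [Finset.mem_filter, hmem] at hp' hω
    exact hω p' ⟨.inr hp'.1, hp'.2⟩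
  · refine Determines.prodMk ?_ (.of_forall fun ω ω' hω => ?_)
    · refine c.determines_view fun ω ω' hω p' hp' => ?_
      rw [Prod.mk.injEq, Prod.mk.injEq, view_eq_iff, view_eq_iff] at hω
      simp only [Finset.mem_filter, hmem, Finset.mem_union] at hp' hω
      exact hω.2 p' ⟨hp'.1, .inr hp'.2⟩
    · exact (Prod.ext_iff.1 (Prod.ext_iff.1 hω).1).2

/-- The symbols of a history, those on the edges of `F₀` and `B` being distinguished. If the tails
of the edges of `F₀ ⊆ fwd V` can be reached within `V` only from the backward edges in `B`, then
`H(X_fwd | outer) + H(X_B | inner) ≤ H(X_{F₀ ∪ B}) + #(fwd \ F₀) log q`. The proof removes a last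
event; by submodularity the removed term of each conditional entropy on the left is at most the
corresponding term in the chain rule for `H(X_{F₀ ∪ B})`. -/
theorem entropy_history_le [Fintype Node] [DecidableEq Node] [Fintype Edge] [DecidableEq Edge]
    {V : Finset Node} (hS : N.source ∈ V) {F₀ B : Finset Edge} (hF₀ : F₀ ⊆ N.fwd V)
    (hB : B ⊆ N.bwd V)
    (hreach : ∀ i ∈ F₀, ∀ j ∈ N.bwd V, N.PathWithin V (N.head j) (N.tail i) → j ∈ B)
    (Q : Finset (Edge × Fin c.T)) (hQ : N.IsHistory Q) :
    entropy c.law (fun ω => (c.view (Q.filter (·.1 ∈ N.fwd V)) ω, c.outer V ω)) +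
        entropy c.law (fun ω => (c.view (Q.filter (·.1 ∈ B)) ω, c.inner V ω)) ≤
      entropy c.law (c.view (Q.filter (·.1 ∈ F₀ ∪ B))) + entropy c.law (c.outer V) +
        entropy c.law (c.inner V) + (Q.filter (·.1 ∈ N.fwd V \ F₀)).card * Real.log c.q := by
  have hmo := c.measurable_outer V
  have hmi := c.measurable_inner V
  obtain ⟨f, hf⟩ := N.exists_rank c.T
  induction hn : Q.card generalizing Q with
  | zero =>
    rw [Finset.card_eq_zero] at hn
    subst hn
    have h1 : entropy c.law (fun ω => (c.view ((∅ : Finset (Edge × Fin c.T)).filter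
        (·.1 ∈ N.fwd V)) ω, c.outer V ω)) ≤ entropy c.law (c.outer V) :=
      Determines.entropy_le hmo ((c.determines_view (by simp)).prodMk ⟨id, by rfl⟩)
    have h2 : entropy c.law (fun ω => (c.view ((∅ : Finset (Edge × Fin c.T)).filter
        (·.1 ∈ B)) ω, c.inner V ω)) ≤ entropy c.law (c.inner V) :=
      Determines.entropy_le hmi ((c.determines_view (by simp)).prodMk ⟨id, by rfl⟩)
    have h3 := entropy_nonneg c.law (c.view ((∅ : Finset (Edge × Fin c.T)).filter
        (·.1 ∈ F₀ ∪ B)))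
    have h4 : (((∅ : Finset (Edge × Fin c.T)).filter (·.1 ∈ N.fwd V \ F₀)).card : ℝ) = 0 := by
      simp
    rw [h4]
    linarith
  | succ n ih =>
    obtain ⟨p, hp, hmax⟩ := Q.exists_max_image f (Finset.card_pos.1 (by omega))
    obtain ⟨Q₀, hQ₀⟩ : ∃ Q₀, Q₀ = Q.erase p := ⟨_, rfl⟩
    have hmem : ∀ p', p' ∈ Q ↔ p' = p ∨ p' ∈ Q₀ := by
      intro p'
      by_cases h : p' = p <;> simp [hQ₀, h, hp]
    have hQ₀' : N.IsHistory Q₀ := by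
      intro p₁ h₁ p₂ h₂
      have h₁' : p₁ ∈ Q := (hmem _).2 (.inr h₁)
      rcases (hmem _).1 (hQ p₁ h₁' p₂ h₂) with rfl | h
      · exact absurd (hf _ _ h₂) (not_lt.2 (hmax _ h₁'))
      · exact h
    have hih := ih Q₀ hQ₀' (by rw [hQ₀, Finset.card_erase_of_mem hp]; omega)
    have hsame : ∀ S : Finset Edge, p.1 ∉ S → Q.filter (·.1 ∈ S) = Q₀.filter (·.1 ∈ S) := by
      intro S hpS
      rw [hQ₀, Finset.filter_erase, Finset.erase_eq_of_notMem (by simp [hpS])]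
    by_cases hpF : p.1 ∈ N.fwd V
    · have hpB : p.1 ∉ B := fun h => (N.mem_bwd.1 (hB h)).1 (N.mem_fwd.1 hpF).1
      rw [hsame B hpB]
      by_cases hpF₀ : p.1 ∈ F₀
      · rw [hsame (N.fwd V \ F₀) (by simp [hpF₀])]
        have h : entropy c.law (fun ω => (c.view (Q.filter (·.1 ∈ N.fwd V)) ω, c.outer V ω)) +
            entropy c.law (c.view (Q₀.filter (·.1 ∈ F₀ ∪ B))) ≤
            entropy c.law (fun ω => (c.view (Q₀.filter (·.1 ∈ N.fwd V)) ω, c.outer V ω)) +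
            entropy c.law (c.view (Q.filter (·.1 ∈ F₀ ∪ B))) :=
          c.entropy_add_entropy_le_outer hS hF₀ hB hmem hQ₀' hpF₀
        linarith
      · have hpFB : p.1 ∉ F₀ ∪ B := by simp [hpF₀, hpB]
        rw [hsame _ hpFB]
        have h : entropy c.law (fun ω => (c.view (Q.filter (·.1 ∈ N.fwd V)) ω, c.outer V ω)) ≤
            entropy c.law (fun ω => (c.view (Q₀.filter (·.1 ∈ N.fwd V)) ω, c.outer V ω)) +
              Real.log (Fintype.card (Fin c.q)) :=
          c.entropy_le_add_log_outer _ hmem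
        have hcard : (Q.filter (·.1 ∈ N.fwd V \ F₀)).card =
            (Q₀.filter (·.1 ∈ N.fwd V \ F₀)).card + 1 := by
          rw [hQ₀, Finset.filter_erase, Finset.card_erase_add_one]
          simp [hp, hpF, hpF₀]
        rw [Fintype.card_fin] at h
        rw [hcard]
        push_cast
        linarith
    · rw [hsame _ hpF, hsame (N.fwd V \ F₀) (by simp [hpF])]
      by_cases hpB : p.1 ∈ B
      · have h : entropy c.law (fun ω => (c.view (Q.filter (·.1 ∈ B)) ω, c.inner V ω)) +
            entropy c.law (c.view (Q₀.filter (·.1 ∈ F₀ ∪ B))) ≤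
            entropy c.law (fun ω => (c.view (Q₀.filter (·.1 ∈ B)) ω, c.inner V ω)) +
            entropy c.law (c.view (Q.filter (·.1 ∈ F₀ ∪ B))) :=
          c.entropy_add_entropy_le_inner hF₀ hreach hmem hQ₀'
        linarith
      · have hpFB : p.1 ∉ F₀ ∪ B := by
          simp only [Finset.mem_union, not_or]
          exact ⟨fun h => hpF (hF₀ h), hpB⟩
        rw [hsame _ hpB, hsame _ hpFB]
        exact hih

/-- If the symbols on the forward edges `F₀` and the backward edges `B₀ ⊆ B` reveal nothing about
the message, and if the tails of the edges of `F₀` can be reached within `V` only from the backward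
edges in `B`, then all the information about the message crosses the cut on the edges of `fwd \ F₀`
and `B \ B₀`. -/
theorem entropy_message_le [Fintype Node] [DecidableEq Node] [Fintype Edge] [DecidableEq Edge]
    (hdec : c.Decodes) {V : Finset Node} (hS : N.source ∈ V) (hD : N.sink ∉ V)
    {F₀ B₀ B : Finset Edge} (hF₀ : F₀ ⊆ N.fwd V) (hB₀ : B₀ ⊆ B) (hB : B ⊆ N.bwd V)
    (hreach : ∀ i ∈ F₀, ∀ j ∈ N.bwd V, N.PathWithin V (N.head j) (N.tail i) → j ∈ B)
    (hsec : ProbabilityTheory.IndepFun (fun ω : c.Sample => ω.1)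
      (c.view (Finset.univ.filter (·.1 ∈ F₀ ∪ B₀))) c.law) :
    entropy c.law (fun ω : c.Sample => ω.1) ≤
      ((N.fwd V \ F₀).card + (B \ B₀).card : ℕ) * (c.T * Real.log c.q) := by
  have hmo := c.measurable_outer V
  have hmi := c.measurable_inner V
  have hmv := c.measurable_view
  have hmm : Measurable fun ω : c.Sample => ω.1 := measurable_fst
  have hcard : ∀ S : Finset Edge,
      ((Finset.univ : Finset (Edge × Fin c.T)).filter (·.1 ∈ S)).card = S.card * c.T := by
    intro S
    have : (Finset.univ : Finset (Edge × Fin c.T)).filter (·.1 ∈ S) = S ×ˢ Finset.univ := by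
      ext; simp
    rw [this, Finset.card_product, Finset.card_univ, Fintype.card_fin]
  have huniv : N.IsHistory (Finset.univ : Finset (Edge × Fin c.T)) :=
    fun _ _ _ _ => Finset.mem_univ _
  have h1 := c.entropy_history_le hS hF₀ hB hreach Finset.univ huniv
  have h2 : entropy c.law (fun ω => (c.inner V ω, c.outer V ω)) +
      entropy c.law (fun ω => (ω.1, c.view (Finset.univ.filter (·.1 ∈ F₀ ∪ B)) ω)) ≤
      entropy c.law (fun ω => (c.view (Finset.univ.filter (·.1 ∈ N.fwd V)) ω, c.outer V ω)) +
      entropy c.law (fun ω => (c.view (Finset.univ.filter (·.1 ∈ B)) ω, c.inner V ω)) := by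
    have hout : ∀ ω ω' : c.Sample, (c.view (Finset.univ.filter (·.1 ∈ N.fwd V)) ω, c.outer V ω) =
        (c.view (Finset.univ.filter (·.1 ∈ N.fwd V)) ω', c.outer V ω') →
        ∀ p : Edge × Fin c.T, (N.tail p.1 ∉ V ∨ N.head p.1 ∉ V) →
          c.signal p.1 p.2 ω = c.signal p.1 p.2 ω' := by
      intro ω ω' hω p hp
      rw [Prod.mk.injEq, view_eq_iff] at hω
      simp only [Finset.mem_filter, Finset.mem_univ, true_and] at hω
      by_cases h : N.tail p.1 ∈ V
      · exact hω.1 p (by simpa [fwd, h] using hp)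
      · exact c.signal_eq_of_outer_eq hS huniv hω.2
          (fun p' _ h2 h3 => hω.1 p' (by simp [fwd, h2, h3])) (Finset.mem_univ p) h
    refine entropy_submodular ((hmv _).prodMk hmo) ((hmv _).prodMk hmi) (hmm.prodMk (hmv _))
      (Determines.prodMk ?_ ?_) (Determines.prodMk ?_ ?_) (.of_forall fun ω ω' hω => ?_)
    · refine Determines.congr_right (Y := fun ω => c.dec (ω.2 N.sink)
        fun p => c.signal p.1.1 p.1.2 ω) (.of_forall fun ω ω' hω => ?_) (by exact hdec)
      have hk : c.dec (ω.2 N.sink) = c.dec (ω'.2 N.sink) :=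
        (Prod.ext_iff.1 (Prod.ext_iff.1 hω).2).1
      have hr : (fun p : N.Received c.T => c.signal p.1.1 p.1.2 ω) =
          fun p => c.signal p.1.1 p.1.2 ω' := by
        funext p
        exact hout ω ω' hω p.1 (.inr (by rw [p.2]; exact hD))
      change c.dec (ω.2 N.sink) _ = c.dec (ω'.2 N.sink) _
      rw [hk, hr]
    · refine c.determines_view fun ω ω' hω p hp => hout ω ω' hω p ?_
      simp only [Finset.mem_filter, Finset.mem_univ, true_and, Finset.mem_union] at hp
      rcases hp with hp | hp
      · exact .inr (by simpa [fwd] using (Finset.mem_filter.1 (hF₀ hp)).2.2)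
      · exact .inl (Finset.mem_filter.1 (hB hp)).2.1
    · exact .of_forall fun ω ω' hω => (Prod.ext_iff.1 (Prod.ext_iff.1 hω).2).1
    · refine c.determines_view fun ω ω' hω p hp => ?_
      rw [Prod.mk.injEq, view_eq_iff] at hω
      simp only [Finset.mem_filter, Finset.mem_univ, true_and, Finset.mem_union] at hp hω
      rcases hp with hp | hp
      · exact c.signal_eq_of_inner_eq huniv hω.2 (fun p' _ h => hω.1 p' h) (Finset.mem_univ p)
          (Finset.mem_filter.1 (hF₀ hp)).2.1
          fun j h1 h2 h3 => hreach _ hp j (by simp [bwd, h1, h2]) h3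
      · exact hω.1 p hp
    · simp only [Prod.mk.injEq] at hω ⊢
      exact ⟨hω.2.2, hω.1.2⟩
  have h3 := entropy_prod_of_indepFun hmi hmo (c.indepFun_inner_outer V hD)
  have h4 := entropy_prod_of_indepFun hmm (hmv _) hsec
  have h5 : entropy c.law (fun ω => (ω.1, c.view (Finset.univ.filter (·.1 ∈ F₀ ∪ B₀)) ω)) ≤
      entropy c.law (fun ω => (ω.1, c.view (Finset.univ.filter (·.1 ∈ F₀ ∪ B)) ω)) := by
    refine Determines.entropy_le (hmm.prodMk (hmv _)) (Determines.prodMk ?_ ?_)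
    · exact .of_forall fun ω ω' hω => (Prod.ext_iff.1 hω).1
    · refine c.determines_view fun ω ω' hω p hp => ?_
      rw [Prod.mk.injEq, view_eq_iff] at hω
      simp only [Finset.mem_filter, Finset.mem_univ, true_and, Finset.mem_union] at hp hω
      exact hω.2 p (hp.imp_right fun h => hB₀ h)
  have h6 := c.entropy_view_union_le (Finset.univ.filter (·.1 ∈ F₀ ∪ B₀))
    (Finset.univ.filter (·.1 ∈ B \ B₀))
  have h7 : (Finset.univ.filter (·.1 ∈ F₀ ∪ B₀) ∪ Finset.univ.filter (·.1 ∈ B \ B₀) :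
      Finset (Edge × Fin c.T)) = Finset.univ.filter (·.1 ∈ F₀ ∪ B) := by
    ext p
    have := @hB₀ p.1
    simp only [Finset.mem_union, Finset.mem_filter, Finset.mem_univ, true_and, Finset.mem_sdiff]
    tauto
  rw [h7] at h6
  rw [hcard] at h1 h6
  push_cast at h1 h6 ⊢
  linarith

/-- The signals on a part of a wiretap set are independent of the message. -/
theorem indepFun_view_of_secure [Fintype Node] [Fintype Edge] [DecidableEq Edge]
    {𝒜 : Finset (Finset Edge)} (hsec : c.Secure 𝒜) {A S : Finset Edge} (hA : A ∈ 𝒜) (hS : S ⊆ A) :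
    ProbabilityTheory.IndepFun (fun ω : c.Sample => ω.1)
      (c.view (Finset.univ.filter (·.1 ∈ S))) c.law := by
  have hmm : Measurable fun ω : c.Sample => ω.1 := measurable_fst
  have hms : Measurable (c.signals A) :=
    measurable_pi_lambda _ fun e => measurable_pi_lambda _ fun t => c.measurable_signal e t
  have h := hsec A hA
  have : IsProbabilityMeasure (c.law.map fun ω : c.Sample => ω.1) :=
    Measure.isProbabilityMeasure_map hmm.aemeasurable
  have : IsProbabilityMeasure (c.law.map (c.signals A)) :=
    Measure.isProbabilityMeasure_map hms.aemeasurable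
  have : IsProbabilityMeasure (c.law.map fun ω : c.Sample => (ω.1, c.signals A ω)) :=
    Measure.isProbabilityMeasure_map (hmm.prodMk hms).aemeasurable
  rw [mutualInfo, InformationTheory.klDiv_eq_zero_iff] at h
  have hind : ProbabilityTheory.IndepFun (fun ω : c.Sample => ω.1) (c.signals A) c.law :=
    (ProbabilityTheory.indepFun_iff_map_prod_eq_prod_map_map hmm.aemeasurable
      hms.aemeasurable).2 h
  refine hind.comp (φ := id) (ψ := fun x (p : (Finset.univ.filter (·.1 ∈ S) :
    Finset (Edge × Fin c.T))) => x ⟨p.1.1, hS (Finset.mem_filter.1 p.2).2⟩ p.1.2)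
    measurable_id ?_
  exact Measurable.of_discrete

theorem msgEntropy_eq [Fintype Node] :
    c.msgEntropy = entropy c.law (fun ω : c.Sample => ω.1) := by
  rw [entropy_eq_sum, msgEntropy]
  refine Finset.sum_congr rfl fun m _ => ?_
  congr 1
  rw [measureReal_def, measureReal_def, ← (measurePreserving_fst
    (μ := (c.msgLaw : Measure (Fin c.msgCard)))
    (ν := Measure.pi fun v => (c.keyLaw v : Measure (c.Key v)))).measure_preimage
    (measurableSet_singleton m).nullMeasurableSet]
  rfl

end Code

/-! ### Comparison with the rank -/

/-- The deficiency version of Hall's theorem, in terms of ranks: over any field some matrix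
supported on the relation `r` has rank at least the minimum over the sets `S` of rows of the number
of rows outside `S` plus the number of columns that are related to a row in `S`. -/
theorem exists_matrix_rank_ge {ι κ F : Type*} [Fintype ι] [Fintype κ] [DecidableEq ι]
    [DecidableEq κ] [Field F] (r : ι → κ → Prop) [∀ i, DecidablePred (r i)] :
    ∃ (W : Matrix ι κ F) (S : Finset ι), (∀ i j, ¬ r i j → W i j = 0) ∧
      Fintype.card ι + ({j | ∃ i ∈ S, r i j} : Finset κ).card ≤ W.rank + S.card := by
  -- `S` has the largest deficiency, which is the number of dummy columns that Hall's theorem needs.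
  obtain ⟨S, -, hS⟩ := Finset.exists_max_image (Finset.univ : Finset (Finset ι))
    (fun S => (S.card : ℤ) - ({j | ∃ i ∈ S, r i j} : Finset κ).card) Finset.univ_nonempty
  have hS0 := hS ∅ (Finset.mem_univ _)
  simp only [Finset.card_empty, Finset.notMem_empty, false_and, exists_false, Finset.filter_false,
    Nat.cast_zero, sub_self] at hS0
  obtain ⟨d, hd⟩ := Int.eq_ofNat_of_zero_le hS0
  obtain ⟨f, hf, hft⟩ := (Finset.all_card_le_biUnion_card_iff_exists_injective
    (fun i => (({j | r i j} : Finset κ).disjSum (Finset.univ : Finset (Fin d))))).1 (by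
      intro S'
      rcases S'.eq_empty_or_nonempty with rfl | ⟨i₀, hi₀⟩
      · simp
      have h1 := hS S' (Finset.mem_univ _)
      have h2 : (({j | ∃ i ∈ S', r i j} : Finset κ).disjSum (Finset.univ : Finset (Fin d))) ⊆
          S'.biUnion fun i => (({j | r i j} : Finset κ).disjSum Finset.univ) := by
        rintro (j | k) h
        · simpa using h
        · simpa using ⟨i₀, hi₀⟩
      have h3 := Finset.card_le_card h2
      rw [Finset.card_disjSum, Finset.card_univ, Fintype.card_fin] at h3
      omega)
  refine ⟨fun i j => if f i = Sum.inl j then 1 else 0, S, fun i j hij => ?_, ?_⟩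
  · refine if_neg fun h => hij ?_
    have := hft i
    rw [h] at this
    simpa using this
  -- The rows matched with genuine columns are distinct unit vectors.
  set W : Matrix ι κ F := fun i j => if f i = Sum.inl j then 1 else 0 with hW
  set J : Finset κ := {j | ∃ i, f i = Sum.inl j} with hJ
  have hrank : J.card ≤ W.rank := by
    rw [W.rank_eq_finrank_span_row]
    have hli : LinearIndependent F fun j : J => (Pi.basisFun F κ) j.1 :=
      (Pi.basisFun F κ).linearIndependent.comp _ Subtype.val_injective
    rw [← Fintype.card_coe, ← finrank_span_eq_card hli]
    refine Submodule.finrank_mono (Submodule.span_mono ?_)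
    rintro _ ⟨⟨j, hj⟩, rfl⟩
    obtain ⟨i, hi⟩ := (Finset.mem_filter.1 hj).2
    refine ⟨i, ?_⟩
    funext j'
    simp [hW, Matrix.row, hi, Pi.single_apply, eq_comm]
  have hcard : Fintype.card ι ≤ J.card + d := by
    have h := Finset.card_le_card (s := Finset.univ.image f)
      (t := J.disjSum (Finset.univ : Finset (Fin d))) (by
        intro u hu
        obtain ⟨i, -, rfl⟩ := Finset.mem_image.1 hu
        rcases h : f i with j | k
        · simpa [hJ] using ⟨i, h⟩
        · simp)
    rwa [Finset.card_image_of_injective _ hf, Finset.card_univ, Finset.card_disjSum,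
      Finset.card_univ, Fintype.card_fin] at h
  omega

theorem rowEdge_injective [DecidableEq Node] [Fintype Edge] (N : SecureNetwork Node Edge)
    (V : Finset Node) : Function.Injective (N.rowEdge V) := by
  have hne : ∀ (i : N.fwd V) (j : N.bwd V), i.1 ≠ j.1 := fun i j h =>
    (Finset.mem_filter.1 j.2).2.1 (h ▸ (Finset.mem_filter.1 i.2).2.1)
  rintro (i | i) (j | j) h
  · exact congrArg Sum.inl (Subtype.ext h)
  · exact absurd h (hne i j)
  · exact absurd h.symm (hne j i)
  · exact congrArg Sum.inr (Subtype.ext h)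

end SecureNetwork

theorem theorem1 {Node Edge : Type*} [Fintype Node] [DecidableEq Node] [Fintype Edge]
    [DecidableEq Edge] (N : SecureNetwork Node Edge) (𝒜 : Finset (Finset Edge))
    (h𝒜 : 𝒜.Nonempty) (V : Finset Node) (hS : N.source ∈ V) (hD : N.sink ∉ V)
    {F : Type*} [Field F] [Finite F] (Cbar : Matrix (N.fwd V ⊕ N.bwd V) (N.bwd V) F)
    (hC : N.IsRankMaximized V 𝒜 Cbar) :
    N.secrecyCapacity 𝒜 ≤
      (((N.fwd V).card + (N.cutWiretaps V 𝒜).inf' (h𝒜.image _)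
        (fun A => ((N.rowsIn V Cbar A).rank : ℝ) - (A.card : ℝ)) : ℝ) : EReal) := by
  refine iSup_le fun c => iSup_le fun hdec => iSup_le fun hsec => ?_
  rw [EReal.coe_le_coe_iff, ← sub_le_iff_le_add']
  refine Finset.le_inf' _ _ fun A hA => ?_
  obtain ⟨A₁, hA₁, hAA₁⟩ := Finset.mem_image.1 hA
  have hAsub : A ⊆ A₁ := hAA₁ ▸ Finset.inter_subset_left
  have hAcut : A ⊆ N.fwd V ∪ N.bwd V := hAA₁ ▸ Finset.inter_subset_right
  classical
  obtain ⟨W, S, hW, hcard⟩ := SecureNetwork.exists_matrix_rank_ge (F := F)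
    fun (i : {r : N.fwd V ⊕ N.bwd V // N.rowEdge V r ∈ A}) (j : N.bwd V) =>
      N.cutMatrix V i.1 j ≠ 0
  have hrank : W.rank ≤ (N.rowsIn V Cbar A).rank :=
    (hC.2 A hA).2 ⟨W, fun i j h => hW i j (not_not.2 h), rfl⟩
  have hrows : A.card ≤ Fintype.card {r : N.fwd V ⊕ N.bwd V // N.rowEdge V r ∈ A} := by
    rw [← Finset.card_univ]
    refine (Finset.card_le_card fun e he => ?_).trans
      (Finset.card_image_le (f := fun r => N.rowEdge V r.1))
    rw [Finset.mem_image]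
    rcases Finset.mem_union.1 (hAcut he) with h | h
    · exact ⟨⟨Sum.inl ⟨e, h⟩, he⟩, Finset.mem_univ _, rfl⟩
    · exact ⟨⟨Sum.inr ⟨e, h⟩, he⟩, Finset.mem_univ _, rfl⟩
  -- The edges of the rows in `S`, split at the cut, and the backward edges of their columns.
  set E : Finset Edge := S.image fun r => N.rowEdge V r.1 with hE
  set B : Finset Edge := ({j | ∃ i ∈ S, N.cutMatrix V i.1 j ≠ 0} : Finset (N.bwd V)).map
    (Function.Embedding.subtype _) with hBdef
  have hEA : E ⊆ A := fun e he => by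
    obtain ⟨r, -, rfl⟩ := Finset.mem_image.1 he
    exact r.2
  have hEcard : E.card = S.card := Finset.card_image_of_injective _
    ((N.rowEdge_injective V).comp Subtype.val_injective)
  have hBcard : B.card = ({j | ∃ i ∈ S, N.cutMatrix V i.1 j ≠ 0} : Finset (N.bwd V)).card :=
    Finset.card_map _
  have hB : B ⊆ N.bwd V := fun e he => by
    obtain ⟨j, -, rfl⟩ := Finset.mem_map.1 he
    exact j.2
  have hB₀ : E ∩ N.bwd V ⊆ B := fun e he => by
    obtain ⟨heE, he⟩ := Finset.mem_inter.1 he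
    obtain ⟨⟨r, hr⟩, hrS, rfl⟩ := Finset.mem_image.1 heE
    have hr' : r = Sum.inr ⟨_, he⟩ := N.rowEdge_injective V rfl
    refine Finset.mem_map.2 ⟨⟨_, he⟩, ?_, rfl⟩
    refine Finset.mem_filter.2 ⟨Finset.mem_univ _, _, hrS, ?_⟩
    change N.cutMatrix V r _ ≠ 0
    generalize hj : (⟨_, he⟩ : N.bwd V) = j at hr'
    rw [hr']
    simp [SecureNetwork.cutMatrix]
  have hreach : ∀ i ∈ E ∩ N.fwd V, ∀ j ∈ N.bwd V,
      N.PathWithin V (N.head j) (N.tail i) → j ∈ B := by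
    intro i hi j hj hpath
    obtain ⟨hiE, hi⟩ := Finset.mem_inter.1 hi
    obtain ⟨⟨r, hr⟩, hrS, hri⟩ := Finset.mem_image.1 hiE
    have hr' : r = Sum.inl ⟨i, hi⟩ := N.rowEdge_injective V hri
    subst hr'
    refine Finset.mem_map.2 ⟨⟨j, hj⟩, Finset.mem_filter.2 ⟨Finset.mem_univ _, _, hrS, ?_⟩, rfl⟩
    simp [SecureNetwork.cutMatrix, SecureNetwork.connMatrix, hpath]
  have hEsplit : E ∩ N.fwd V ∪ E ∩ N.bwd V = E := by
    rw [← Finset.inter_union_distrib_left, Finset.inter_eq_left]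
    exact hEA.trans hAcut
  have hdisj : Disjoint (E ∩ N.fwd V) (E ∩ N.bwd V) := by
    rw [Finset.disjoint_left]
    intro e h1 h2
    exact (Finset.mem_filter.1 (Finset.mem_inter.1 h2).2).2.1
      (Finset.mem_filter.1 (Finset.mem_inter.1 h1).2).2.1
  have hbound := c.entropy_message_le hdec hS hD Finset.inter_subset_right hB₀ hB hreach
    (by rw [hEsplit]; exact c.indepFun_view_of_secure hsec hA₁ (hEA.trans hAsub))
  rw [← c.msgEntropy_eq] at hbound
  have hT : (0 : ℝ) < c.T * Real.log c.q :=
    mul_pos (by exact_mod_cast c.T_pos) (Real.log_pos (by exact_mod_cast c.two_le_q))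
  have hrate : c.rate ≤ ((N.fwd V \ (E ∩ N.fwd V)).card + (B \ (E ∩ N.bwd V)).card : ℕ) :=
    (div_le_iff₀ hT).2 hbound
  have h1 := Finset.card_sdiff_add_card_eq_card (s := E ∩ N.fwd V) (t := N.fwd V)
    Finset.inter_subset_right
  have h2 := Finset.card_sdiff_add_card_eq_card hB₀
  have h3 := Finset.card_union_of_disjoint hdisj
  rw [hEsplit] at h3
  have h4 : (N.fwd V \ (E ∩ N.fwd V)).card + (B \ (E ∩ N.bwd V)).card + A.card ≤
      (N.fwd V).card + (N.rowsIn V Cbar A).rank := by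
    omega
  have h5 : (((N.fwd V \ (E ∩ N.fwd V)).card + (B \ (E ∩ N.bwd V)).card : ℕ) : ℝ) + A.card ≤
      (N.fwd V).card + (N.rowsIn V Cbar A).rank := by
    exact_mod_cast h4
  linarith
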